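/- For every constant $K>0$ there is a constant $c>0$, depending only on $K$, such that the following holds for every dimension $d$, every positive definite matrix $\Sigma\in\mathbb{R}^{d\times d}$ and all $\mu_0,\mu_1,\mu_0',\mu_1'\in\mathbb{R}^d$. Let $$f=\tfrac12\mathcal{N}(\mu_0,\Sigma)+\tfrac12\mathcal{N}(\mu_1,\Sigma),\qquad f'=\tfrac12\mathcal{N}(\mu_0',\Sigma)+\tfrac12\mathcal{N}(\mu_1',\Sigma),$$ and let $\|f-f'\|_{\mathrm{TV}}=\sup_A\big(f(A)-f'(A)\big)$, the supremum being over all Borel sets $A\subseteq\mathbb{R}^d$. Let $$S_1=\{\mu_1-\mu_0,\ \mu_1'-\mu_0'\},\quad S_2=\{\mu_0'-\mu_0,\ \mu_1'-\mu_1\},\quad S_3=\{\mu_0'-\mu_1,\ \mu_1'-\mu_0\},$$ let $v_i$ be a vector of largest Euclidean norm in $S_i$ for $i=1,2,3$ (ties broken arbitrarily), let $U=\operatorname{span}(v_1,v_2,v_3)$, and let $\lambda=\max\{u^{T}\Sigma u : u\in U,\ \|u\|_2=1\}$. (If all four means coincide, then $U=\{0\}$; in this trivial case $\lambda$ and the quotients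 below are read as $0$.) If $\|v_1\|_2\ge \min(\|v_2\|_2,\|v_3\|_2)/2$ and $\sqrt{\lambda}\ge K\|v_1\|_2$, then $$\|f-f'\|_{\mathrm{TV}}\ \ge\ c\,\min\Big(1,\ \frac{\|v_1\|_2\,\min(\|v_2\|_2,\|v_3\|_2)}{\lambda}\Big).$$ Otherwise, $$\|f-f'\|_{\mathrm{TV}}\ \ge\ c\,\min\Big(1,\ \frac{\min(\|v_2\|_2,\|v_3\|_2)}{\sqrt{\lambda}}\Big).$$ -/

import Mathlib

open MeasureTheory ProbabilityTheory
open scoped ENNReal Matrix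

/-- The equally weighted mixture `½ N(μ₀, S) + ½ N(μ₁, S)` on `ℝ^d`. -/
noncomputable def gaussianMixture {d : ℕ} (μ₀ μ₁ : EuclideanSpace ℝ (Fin d))
    (S : Matrix (Fin d) (Fin d) ℝ) : Measure (EuclideanSpace ℝ (Fin d)) :=
  (2⁻¹ : ℝ≥0∞) • multivariateGaussian μ₀ S + (2⁻¹ : ℝ≥0∞) • multivariateGaussian μ₁ S

/-- Total variation distance: the supremum of `f A - f' A` over measurable sets `A`. -/
noncomputable def tvDist {Ω : Type*} [MeasurableSpace Ω] (f f' : Measure Ω) : ℝ :=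
  sSup {r : ℝ | ∃ A : Set Ω, MeasurableSet A ∧ r = f.real A - f'.real A}

/-- `v` is a choice of `argmax_{s ∈ T} ‖s‖`. -/
def IsLongestIn {E : Type*} [Norm E] (T : Set E) (v : E) : Prop :=
  v ∈ T ∧ ∀ s ∈ T, ‖s‖ ≤ ‖v‖

/-- The values `uᵀ S u` over the unit vectors `u` of the subspace `U`. -/
def unitQuadValues {d : ℕ} (S : Matrix (Fin d) (Fin d) ℝ)
    (U : Submodule ℝ (EuclideanSpace ℝ (Fin d))) : Set ℝ :=
  {r | ∃ u : EuclideanSpace ℝ (Fin d), ‖u‖ = 1 ∧ u ∈ U ∧ r = u.ofLp ⬝ᵥ (S *ᵥ u.ofLp)}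

/-- The largest value of `uᵀ S u` over the unit vectors `u` of the subspace `U`. It is a maximum
whenever `U ≠ ⊥` (see `isGreatest_lambdaMax`), and `0` by convention for `U = ⊥`. -/
noncomputable def lambdaMax {d : ℕ} (S : Matrix (Fin d) (Fin d) ℝ)
    (U : Submodule ℝ (EuclideanSpace ℝ (Fin d))) : ℝ :=
  sSup (unitQuadValues S U)

theorem isGreatest_lambdaMax {d : ℕ} (S : Matrix (Fin d) (Fin d) ℝ)
    (U : Submodule ℝ (EuclideanSpace ℝ (Fin d))) (hU : U ≠ ⊥) :
    IsGreatest (unitQuadValues S U) (lambdaMax S U) := by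
  have himg : unitQuadValues S U =
      (fun u : EuclideanSpace ℝ (Fin d) => u.ofLp ⬝ᵥ (S *ᵥ u.ofLp)) ''
        (Metric.sphere 0 1 ∩ (U : Set (EuclideanSpace ℝ (Fin d)))) := by
    ext r
    simp only [unitQuadValues, Set.mem_ofPred_eq, Set.mem_image, Set.mem_inter_iff,
      mem_sphere_zero_iff_norm, SetLike.mem_coe]
    constructor
    · rintro ⟨u, h1, h2, h3⟩
      exact ⟨u, ⟨h1, h2⟩, h3.symm⟩
    · rintro ⟨u, ⟨h1, h2⟩, h3⟩
      exact ⟨u, h1, h2, h3.symm⟩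
  have hcpt : IsCompact (unitQuadValues S U) := by
    rw [himg]
    refine ((isCompact_sphere _ _).inter_right U.closed_of_finiteDimensional).image ?_
    fun_prop
  refine hcpt.isGreatest_sSup ?_
  obtain ⟨x, hx, hx0⟩ := U.exists_mem_ne_zero_of_ne_bot hU
  exact ⟨_, ‖x‖⁻¹ • x, by simp [norm_smul, hx0], U.smul_mem _ hx, rfl⟩

/-! ### Total variation and bounded test functions -/

section TotalVariation

variable {Ω : Type*} [MeasurableSpace Ω] {f f' : Measure Ω}

/-! Total variation controls differences of integrals of cosines, that is, of characteristic
functions. At a frequency `w` the common covariance gives a factor `exp (-wᵀSw/2)`, and a suitable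
phase factors the remaining four cosines into `sin X * sin Y * cos B` or `cos X * cos Y * sin B`
(`trig_prod_le_tvDist_gaussianMixture`). Here `4X`, `4Y`, `4B` are the inner products of `w` with
the difference and the sum of the two center gaps and with the shift of the sum of the means; up to
signs, `2v₁`, `2v₂`, `2v₃` are sums of two of these three vectors.

Take `w = (t / √λ) • u` with `u ∈ U` bounded and `|⟪u, vᵢ⟫|` comparable to `‖vᵢ‖` for all `i`; the
exponential is then at least `exp (-2)`. A good `t ∈ [0, 1]` yields a bound of order `min 1
(‖v₁‖/√λ) * min 1 (min ‖v₂‖ ‖v₃‖/√λ)` (`min_mul_min_le_tvDist`). This settles the first regime, and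
also the second when `‖v₁‖/√λ` is bounded below. If instead `v₁` is short, the direction of `v₂`
alone gives the linear bound (`min_div_sqrt_le_tvDist`). -/

lemma measureReal_sub_le_tvDist [IsProbabilityMeasure f] {A : Set Ω} (hA : MeasurableSet A) :
    f.real A - f'.real A ≤ tvDist f f' := by
  refine le_csSup ⟨1, ?_⟩ ⟨A, hA, rfl⟩
  rintro r ⟨B, -, rfl⟩
  linarith [measureReal_le_one (μ := f) (s := B), measureReal_nonneg (μ := f') (s := B)]

lemma tvDist_nonneg [IsProbabilityMeasure f] : 0 ≤ tvDist f f' := by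
  simpa using measureReal_sub_le_tvDist (f := f) (f' := f') MeasurableSet.empty

/-- Layer cake: both integrals average measures of superlevel sets over `t ∈ (0, 1]`. -/
lemma integral_sub_integral_le_tvDist [IsProbabilityMeasure f] [IsProbabilityMeasure f']
    {g : Ω → ℝ} (hg : Measurable g) (h0 : ∀ x, 0 ≤ g x) (h1 : ∀ x, g x ≤ 1) :
    ∫ x, g x ∂f - ∫ x, g x ∂f' ≤ tvDist f f' := by
  have key (ν : Measure Ω) [IsProbabilityMeasure ν] :
      ∫ x, g x ∂ν = ∫ t in Set.Ioc (0 : ℝ) 1, ν.real {a | t ≤ g a} :=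
    Integrable.integral_eq_integral_Ioc_meas_le
      (Integrable.of_bound hg.aestronglyMeasurable 1
        (.of_forall fun x => by rw [Real.norm_of_nonneg (h0 x)]; exact h1 x))
      (.of_forall h0) (.of_forall h1)
  have hint (ν : Measure Ω) [IsProbabilityMeasure ν] :
      IntegrableOn (fun t : ℝ => ν.real {a | t ≤ g a}) (Set.Ioc 0 1) := by
    have hanti : Antitone fun t : ℝ => ν.real {a | t ≤ g a} := fun s t hst =>
      measureReal_mono fun a (ha : t ≤ g a) => hst.trans ha
    exact ((hanti.antitoneOn _).integrableOn_isCompact isCompact_Icc).mono_set Set.Ioc_subset_Icc_self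
  rw [key f, key f', ← integral_sub (hint f) (hint f')]
  calc _ ≤ ∫ _t in Set.Ioc (0 : ℝ) 1, tvDist f f' :=
        integral_mono ((hint f).sub (hint f')) (integrable_const _)
          fun t => measureReal_sub_le_tvDist (hg measurableSet_Ici)
    _ = tvDist f f' := by simp

lemma abs_integral_sub_integral_le_two_mul_tvDist [IsProbabilityMeasure f]
    [IsProbabilityMeasure f'] {g : Ω → ℝ} (hg : Measurable g) (h1 : ∀ x, |g x| ≤ 1) :
    |∫ x, g x ∂f - ∫ x, g x ∂f'| ≤ 2 * tvDist f f' := by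
  have hi (ν : Measure Ω) [IsProbabilityMeasure ν] : Integrable g ν :=
    Integrable.of_bound hg.aestronglyMeasurable 1 (.of_forall h1)
  have key (s : ℝ) (hs : |s| = 1) :
      s * (∫ x, g x ∂f - ∫ x, g x ∂f') ≤ 2 * tvDist f f' := by
    have hb (x : Ω) : |s * g x| ≤ 1 := by rw [abs_mul, hs, one_mul]; exact h1 x
    have h := integral_sub_integral_le_tvDist (f := f) (f' := f')
      (g := fun x => 2⁻¹ + 2⁻¹ * (s * g x)) (by fun_prop)
      (fun x => by linarith [(abs_le.1 (hb x)).1]) (fun x => by linarith [(abs_le.1 (hb x)).2])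
    have e (ν : Measure Ω) [IsProbabilityMeasure ν] :
        ∫ x, (2⁻¹ + 2⁻¹ * (s * g x)) ∂ν = 2⁻¹ + 2⁻¹ * (s * ∫ x, g x ∂ν) := by
      rw [integral_add (integrable_const _) (((hi ν).const_mul s).const_mul _),
        integral_const_mul, integral_const_mul]
      simp
    rw [e f, e f'] at h
    linarith
  rw [abs_le]
  constructor
  · linarith [key (-1) (by simp)]
  · linarith [key 1 (by simp)]

end TotalVariation

/-! ### Characteristic functions of the mixtures -/

section GaussianMixture

open scoped RealInnerProductSpace

variable {d : ℕ} {S : Matrix (Fin d) (Fin d) ℝ}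

instance isProbabilityMeasure_gaussianMixture (μ₀ μ₁ : EuclideanSpace ℝ (Fin d)) :
    IsProbabilityMeasure (gaussianMixture μ₀ μ₁ S) :=
  ⟨by simp [gaussianMixture, ENNReal.inv_two_add_inv_two]⟩

lemma integral_cos_multivariateGaussian (hS : S.PosSemidef) (μ w : EuclideanSpace ℝ (Fin d))
    (θ : ℝ) :
    ∫ z, Real.cos (⟪w, z⟫ - θ) ∂(multivariateGaussian μ S) =
      Real.exp (-(w.ofLp ⬝ᵥ (S *ᵥ w.ofLp)) / 2) * Real.cos (⟪w, μ⟫ - θ) := by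
  have hint : Integrable (fun z => Complex.exp (⟪z, w⟫ * Complex.I) * Complex.exp (-θ * Complex.I))
      (multivariateGaussian μ S) := by
    refine Integrable.of_bound (Continuous.aestronglyMeasurable (by fun_prop)) 1 (.of_forall ?_)
    intro z
    rw [norm_mul, Complex.norm_exp_ofReal_mul_I, ← Complex.ofReal_neg,
      Complex.norm_exp_ofReal_mul_I, one_mul]
  have hre (s : ℝ) : (Complex.exp (s * Complex.I) * Complex.exp (-θ * Complex.I)).re =
      Real.cos (s - θ) := by
    rw [← Complex.exp_add, ← add_mul, ← sub_eq_add_neg, ← Complex.ofReal_sub,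
      Complex.exp_ofReal_mul_I_re]
  calc _ = ∫ z, Complex.reCLM (Complex.exp (⟪z, w⟫ * Complex.I) * Complex.exp (-θ * Complex.I))
        ∂(multivariateGaussian μ S) := by
        refine integral_congr_ae (.of_forall fun z => ?_)
        simp only [Complex.reCLM_apply]
        rw [hre, real_inner_comm]
    _ = (charFun (multivariateGaussian μ S) w * Complex.exp (-θ * Complex.I)).re := by
        rw [ContinuousLinearMap.integral_comp_comm _ hint, integral_mul_const, charFun_apply]
        rfl
    _ = _ := by
        rw [charFun_multivariateGaussian hS, sub_eq_neg_add, Complex.exp_add, mul_assoc,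
          ← hre ⟪w, μ⟫, ← Complex.re_ofReal_mul, Complex.ofReal_exp]
        push_cast
        rw [neg_div]

lemma integral_cos_gaussianMixture (hS : S.PosSemidef) (μ₀ μ₁ w : EuclideanSpace ℝ (Fin d))
    (θ : ℝ) :
    ∫ z, Real.cos (⟪w, z⟫ - θ) ∂(gaussianMixture μ₀ μ₁ S) =
      Real.exp (-(w.ofLp ⬝ᵥ (S *ᵥ w.ofLp)) / 2) / 2 *
        (Real.cos (⟪w, μ₀⟫ - θ) + Real.cos (⟪w, μ₁⟫ - θ)) := by
  have hi (μ : EuclideanSpace ℝ (Fin d)) : Integrable (fun z => Real.cos (⟪w, z⟫ - θ))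
      ((2⁻¹ : ℝ≥0∞) • multivariateGaussian μ S) :=
    (Integrable.of_bound (Continuous.aestronglyMeasurable (by fun_prop)) 1
      (.of_forall fun z => Real.abs_cos_le_one _)).smul_measure (by simp)
  rw [gaussianMixture, integral_add_measure (hi _) (hi _), integral_smul_measure,
    integral_smul_measure, integral_cos_multivariateGaussian hS,
    integral_cos_multivariateGaussian hS]
  simp only [ENNReal.toReal_inv, ENNReal.toReal_ofNat, smul_eq_mul]
  ring

lemma abs_cos_sum_le_tvDist_gaussianMixture (hS : S.PosSemidef)
    (μ₀ μ₁ μ₀' μ₁' w : EuclideanSpace ℝ (Fin d)) (θ : ℝ) :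
    Real.exp (-(w.ofLp ⬝ᵥ (S *ᵥ w.ofLp)) / 2) *
      |Real.cos (⟪w, μ₀⟫ - θ) + Real.cos (⟪w, μ₁⟫ - θ)
        - Real.cos (⟪w, μ₀'⟫ - θ) - Real.cos (⟪w, μ₁'⟫ - θ)| ≤
      4 * tvDist (gaussianMixture μ₀ μ₁ S) (gaussianMixture μ₀' μ₁' S) := by
  have h := abs_integral_sub_integral_le_two_mul_tvDist (f := gaussianMixture μ₀ μ₁ S)
    (f' := gaussianMixture μ₀' μ₁' S) (g := fun z => Real.cos (⟪w, z⟫ - θ))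
    (Continuous.measurable (by fun_prop)) (fun z => Real.abs_cos_le_one _)
  rw [integral_cos_gaussianMixture hS, integral_cos_gaussianMixture hS, ← mul_sub, abs_mul,
    abs_of_nonneg (by positivity), ← sub_sub] at h
  linarith

/-- A lower bound for the total variation distance through the characteristic functions at `w`,
factored into sines and cosines of inner products with combinations of the means. -/
lemma trig_prod_le_tvDist_gaussianMixture (hS : S.PosSemidef)
    (μ₀ μ₁ μ₀' μ₁' w : EuclideanSpace ℝ (Fin d)) {X Y B : ℝ}
    (hX : ⟪w, (μ₁ - μ₀) - (μ₁' - μ₀')⟫ = 4 * X) (hY : ⟪w, (μ₁ - μ₀) + (μ₁' - μ₀')⟫ = 4 * Y)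
    (hB : ⟪w, (μ₀' + μ₁') - (μ₀ + μ₁)⟫ = 4 * B) :
    Real.exp (-(w.ofLp ⬝ᵥ (S *ᵥ w.ofLp)) / 2) *
        max |Real.sin X * Real.sin Y * Real.cos B| |Real.cos X * Real.cos Y * Real.sin B| ≤
      tvDist (gaussianMixture μ₀ μ₁ S) (gaussianMixture μ₀' μ₁' S) := by
  simp only [inner_add_right, inner_sub_right] at hX hY hB
  -- Centering the phase at the mean of the four inner products makes them signed sums of `X`, `Y`,
  -- `B`.
  obtain ⟨θ, hθ⟩ : ∃ θ, θ = (⟪w, μ₀⟫ + ⟪w, μ₁⟫ + ⟪w, μ₀'⟫ + ⟪w, μ₁'⟫) / 4 := ⟨_, rfl⟩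
  have e0 : ⟪w, μ₀⟫ = θ - B - X - Y := by linarith
  have e1 : ⟪w, μ₁⟫ = θ - B + X + Y := by linarith
  have e2 : ⟪w, μ₀'⟫ = θ + B - Y + X := by linarith
  have e3 : ⟪w, μ₁'⟫ = θ + B + Y - X := by linarith
  rw [mul_max_of_nonneg _ _ (Real.exp_pos _).le]
  refine max_le ?_ ?_
  · have h := abs_cos_sum_le_tvDist_gaussianMixture hS μ₀ μ₁ μ₀' μ₁' w θ
    have e : Real.cos (θ - B - X - Y - θ) + Real.cos (θ - B + X + Y - θ)
        - Real.cos (θ + B - Y + X - θ) - Real.cos (θ + B + Y - X - θ) =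
        -4 * (Real.sin X * Real.sin Y * Real.cos B) := by
      rw [show θ - B - X - Y - θ = -(B + X + Y) by ring, show θ - B + X + Y - θ = X + Y - B by ring,
        show θ + B - Y + X - θ = B - Y + X by ring, show θ + B + Y - X - θ = B + Y - X by ring]
      simp only [Real.cos_neg, Real.cos_add, Real.cos_sub, Real.sin_add, Real.sin_sub]
      ring
    rw [e0, e1, e2, e3, e, abs_mul, abs_neg, abs_of_pos (by norm_num : (0 : ℝ) < 4)] at h
    linarith
  -- A quarter-period shift turns the cosines into sines and isolates the part odd in `B`.
  · have h := abs_cos_sum_le_tvDist_gaussianMixture hS μ₀ μ₁ μ₀' μ₁' w (θ + Real.pi / 2)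
    have e : Real.cos (θ - B - X - Y - (θ + Real.pi / 2))
        + Real.cos (θ - B + X + Y - (θ + Real.pi / 2))
        - Real.cos (θ + B - Y + X - (θ + Real.pi / 2))
        - Real.cos (θ + B + Y - X - (θ + Real.pi / 2)) =
        -4 * (Real.cos X * Real.cos Y * Real.sin B) := by
      rw [show θ - B - X - Y - (θ + Real.pi / 2) = -(B + X + Y) - Real.pi / 2 by ring,
        show θ - B + X + Y - (θ + Real.pi / 2) = X + Y - B - Real.pi / 2 by ring,
        show θ + B - Y + X - (θ + Real.pi / 2) = B - Y + X - Real.pi / 2 by ring,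
        show θ + B + Y - X - (θ + Real.pi / 2) = B + Y - X - Real.pi / 2 by ring]
      simp only [Real.cos_sub_pi_div_two]
      simp only [Real.sin_neg, Real.cos_add, Real.cos_sub, Real.sin_add, Real.sin_sub]
      ring
    rw [e0, e1, e2, e3, e, abs_mul, abs_neg, abs_of_pos (by norm_num : (0 : ℝ) < 4)] at h
    linarith

end GaussianMixture

/-! ### Choosing a scale that avoids zeros of the trigonometric factors -/

section Trigonometry

lemma abs_sin_abs (x : ℝ) : |(Real.sin |x|)| = |Real.sin x| := by
  rcases abs_choice x with h | h <;> simp [h]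

lemma abs_div_two_le_abs_sin {x : ℝ} (hx : |x| ≤ 1) : |x| / 2 ≤ |Real.sin x| := by
  rw [← abs_sin_abs x]
  refine le_trans ?_ (le_abs_self _)
  have h := Real.mul_le_sin (abs_nonneg x) (by linarith [Real.pi_gt_three])
  have h2 : 1 / 2 ≤ 2 / Real.pi := by
    rw [div_le_div_iff₀ two_pos Real.pi_pos]; linarith [Real.pi_lt_four]
  nlinarith [abs_nonneg x]

lemma half_le_abs_cos {x : ℝ} (hx : |x| ≤ 1) : 1 / 2 ≤ |Real.cos x| := by
  refine le_trans ?_ (le_abs_self _)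
  have := Real.one_sub_sq_div_two_le_cos (x := x)
  nlinarith [sq_abs x, abs_nonneg x]

lemma half_le_abs_cos_or_half (x : ℝ) : 1 / 2 ≤ |Real.cos x| ∨ 1 / 2 ≤ |Real.cos (x / 2)| := by
  by_contra! h
  obtain ⟨h1, h2⟩ := h
  have e : Real.cos x = 2 * Real.cos (x / 2) ^ 2 - 1 := by
    rw [← Real.cos_two_mul]; congr 1; ring
  rw [abs_lt] at h1
  nlinarith [sq_abs (Real.cos (x / 2)), abs_nonneg (Real.cos (x / 2))]

lemma exists_min_le_abs_sin_mul (x : ℝ) :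
    ∃ s : ℝ, 1 / 2 ≤ s ∧ s ≤ 1 ∧ min 1 |x| / 8 ≤ |Real.sin (s * x)| := by
  rcases le_or_gt |x| 1 with hx | hx
  · refine ⟨1, by norm_num, le_rfl, ?_⟩
    rw [min_eq_right hx, one_mul]
    linarith [abs_div_two_le_abs_sin hx, abs_nonneg x]
  · rw [min_eq_left hx.le]
    by_cases h : 1 / 8 ≤ |Real.sin x|
    · exact ⟨1, by norm_num, le_rfl, by simpa using h⟩
    · push Not at h
      have hx0 : 0 < |x| := by linarith
      have hs0 : 0 < 1 / (2 * |x|) := by positivity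
      have hs1 : 1 / (2 * |x|) ≤ 1 / 2 := by
        apply one_div_le_one_div_of_le two_pos; linarith
      -- This moves `|x|`, which is near a zero of sine, back by exactly `1/2`.
      refine ⟨1 - 1 / (2 * |x|), by linarith, by linarith, ?_⟩
      rw [← abs_sin_abs, abs_mul, abs_of_nonneg (by linarith : 0 ≤ 1 - 1 / (2 * |x|)),
        show (1 - 1 / (2 * |x|)) * |x| = |x| - 1 / 2 by field_simp, Real.sin_sub]
      rw [← abs_sin_abs] at h
      have hsin : 2 / 5 ≤ Real.sin (1 / 2) := by
        have := Real.sin_gt_sub_cube (x := 1 / 2) (by norm_num)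
        norm_num at this ⊢
        linarith
      have hcos : 7 / 8 ≤ |(Real.cos |x|)| := by
        have := Real.sin_sq_add_cos_sq |x|
        rw [← sq_abs (Real.sin _), ← sq_abs (Real.cos _)] at this
        nlinarith [abs_nonneg (Real.sin |x|), abs_nonneg (Real.cos |x|)]
      have h2 := Real.abs_cos_le_one (1 / 2)
      have h3 := abs_sub_abs_le_abs_sub (Real.cos |x| * Real.sin (1 / 2))
        (Real.sin |x| * Real.cos (1 / 2))
      rw [abs_sub_comm, abs_mul, abs_mul, abs_of_nonneg (by linarith : 0 ≤ Real.sin (1 / 2))] at h3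
      nlinarith [abs_nonneg (Real.sin |x|), abs_nonneg (Real.cos (1 / 2))]

lemma div_max_one_eq_min_one (a : ℝ) : a / max 1 a = min 1 a := by
  rcases le_total a 1 with h | h
  · rw [max_eq_left h, min_eq_right h, div_one]
  · rw [max_eq_right h, min_eq_left h, div_self (by linarith)]

/-- Scaling `B` to size at most `1` controls `X` too, but `Y` is arbitrary; one of the scales `τ`,
`τ / 2` keeps `cos (t * Y)` away from zero. -/
lemma exists_min_le_abs_cos_cos_sin {X B : ℝ} (Y : ℝ) (h : |X| ≤ |B|) :
    ∃ t : ℝ, 0 ≤ t ∧ t ≤ 1 ∧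
      min 1 |B| / 16 ≤ |Real.cos (t * X) * Real.cos (t * Y) * Real.sin (t * B)| := by
  have hM : 1 ≤ max 1 |B| := le_max_left _ _
  obtain ⟨τ, hτ⟩ : ∃ τ, τ = 1 / max 1 |B| := ⟨_, rfl⟩
  have hτ0 : 0 < τ := hτ ▸ by positivity
  have hτ1 : τ ≤ 1 := by rw [hτ, div_le_one (by linarith)]; exact hM
  have hτB : τ * |B| = min 1 |B| := by
    rw [hτ, one_div_mul_eq_div, div_max_one_eq_min_one |B|]
  have key (t : ℝ) (h1 : τ / 2 ≤ t) (h2 : t ≤ τ) (hc : 1 / 2 ≤ |Real.cos (t * Y)|) :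
      min 1 |B| / 16 ≤ |Real.cos (t * X) * Real.cos (t * Y) * Real.sin (t * B)| := by
    have ht0 : 0 ≤ t := by linarith
    have hB1 : |t * B| ≤ 1 := by
      rw [abs_mul, abs_of_nonneg ht0]
      nlinarith [min_le_left 1 |B|, abs_nonneg B]
    have hX1 : |t * X| ≤ 1 := by
      refine le_trans ?_ hB1
      rw [abs_mul, abs_mul]
      gcongr
    have hs : min 1 |B| / 4 ≤ |Real.sin (t * B)| := by
      refine le_trans ?_ (abs_div_two_le_abs_sin hB1)
      rw [abs_mul, abs_of_nonneg ht0, ← hτB]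
      nlinarith [abs_nonneg B]
    rw [abs_mul, abs_mul]
    calc min 1 |B| / 16 = 1 / 2 * (1 / 2) * (min 1 |B| / 4) := by ring
      _ ≤ _ := by gcongr; exact half_le_abs_cos hX1
  rcases half_le_abs_cos_or_half (τ * Y) with hc | hc
  · exact ⟨τ, hτ0.le, hτ1, key τ (by linarith) le_rfl hc⟩
  · rw [mul_div_right_comm] at hc
    exact ⟨τ / 2, by linarith, by linarith, key _ le_rfl (by linarith) hc⟩

/-- `τ` brings `X`, hence `B`, into `[-1, 1]`. As `Y` may stay large, a further factor `s ∈ [1/2,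
1]` avoids the zeros of its sine. -/
lemma exists_min_le_abs_sin_sin_cos {X Y B : ℝ} (hB : |B| ≤ |X|) (hY : |X| ≤ |Y|) :
    ∃ t : ℝ, 0 ≤ t ∧ t ≤ 1 ∧
      min 1 |X| * min 1 |Y| / 64 ≤ |Real.sin (t * X) * Real.sin (t * Y) * Real.cos (t * B)| := by
  have hM : 1 ≤ max 1 |X| := le_max_left _ _
  obtain ⟨τ, hτ⟩ : ∃ τ, τ = 1 / max 1 |X| := ⟨_, rfl⟩
  have hτ0 : 0 < τ := hτ ▸ by positivity
  have hτ1 : τ ≤ 1 := by rw [hτ, div_le_one (by linarith)]; exact hM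
  have hτX : τ * |X| = min 1 |X| := by
    rw [hτ, one_div_mul_eq_div, div_max_one_eq_min_one |X|]
  have hτY : min 1 |Y| ≤ min 1 |τ * Y| := by
    refine le_min (min_le_left _ _) ?_
    rw [abs_mul, abs_of_pos hτ0, ← div_max_one_eq_min_one |Y|, hτ,
      one_div_mul_eq_div]
    gcongr
  obtain ⟨s, hs0, hs1, hs⟩ := exists_min_le_abs_sin_mul (τ * Y)
  have ht0 : 0 ≤ s * τ := by positivity
  refine ⟨s * τ, ht0, by nlinarith, ?_⟩
  have hX1 : |s * τ * X| ≤ 1 := by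
    rw [abs_mul, abs_of_nonneg ht0, mul_assoc, hτX]
    nlinarith [min_le_left 1 |X|, le_min zero_le_one (abs_nonneg X)]
  have hB1 : |s * τ * B| ≤ 1 := by
    refine le_trans ?_ hX1
    rw [abs_mul (s * τ), abs_mul (s * τ)]
    gcongr
  have h1 : min 1 |X| / 4 ≤ |Real.sin (s * τ * X)| := by
    refine le_trans ?_ (abs_div_two_le_abs_sin hX1)
    rw [abs_mul, abs_of_nonneg ht0, mul_assoc, hτX]
    nlinarith [le_min zero_le_one (abs_nonneg X)]
  have h2 : min 1 |Y| / 8 ≤ |Real.sin (s * τ * Y)| := by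
    rw [mul_assoc]
    linarith
  rw [abs_mul, abs_mul]
  calc min 1 |X| * min 1 |Y| / 64 = min 1 |X| / 4 * (min 1 |Y| / 8) * (1 / 2) := by ring
    _ ≤ _ := by gcongr; exact half_le_abs_cos hB1

lemma min_one_div_two_le {a b : ℝ} (h : a ≤ 2 * b) : min 1 a / 2 ≤ min 1 b :=
  le_min (by linarith [min_le_left 1 a]) (by linarith [min_le_right 1 a])

lemma exists_le_max_trig_prod {X Y B p m : ℝ} (hp0 : 0 ≤ p) (hm0 : 0 ≤ m)
    (hp : p ≤ |X| + |Y|) (hX : m ≤ |B| + |X|) (hY : m ≤ |B| + |Y|) :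
    ∃ t : ℝ, 0 ≤ t ∧ t ≤ 1 ∧
      min 1 m * min 1 p / 256 ≤
        max |Real.sin (t * X) * Real.sin (t * Y) * Real.cos (t * B)|
          |Real.cos (t * X) * Real.cos (t * Y) * Real.sin (t * B)| := by
  wlog h : |X| ≤ |Y| generalizing X Y
  · obtain ⟨t, h0, h1, ht⟩ := this (X := Y) (Y := X) (by linarith) hY hX (le_of_not_ge h)
    exact ⟨t, h0, h1, by
      rwa [mul_comm (Real.sin (t * X)), mul_comm (Real.cos (t * X))]⟩
  have hm1 : 0 ≤ min 1 m := le_min zero_le_one hm0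
  have hp1 : 0 ≤ min 1 p := le_min zero_le_one hp0
  -- The larger of `|B|`, `|X|` is at least `m / 2`, and `|Y| ≥ p / 2` as `Y` dominates `X`.
  rcases le_total |X| |B| with hb | hb
  · obtain ⟨t, h0, h1, ht⟩ := exists_min_le_abs_cos_cos_sin Y hb
    refine ⟨t, h0, h1, le_max_of_le_right (le_trans ?_ ht)⟩
    have := min_one_div_two_le (a := m) (b := |B|) (by linarith)
    nlinarith [min_le_left 1 p]
  · obtain ⟨t, h0, h1, ht⟩ := exists_min_le_abs_sin_sin_cos hb h
    refine ⟨t, h0, h1, le_max_of_le_left (le_trans ?_ ht)⟩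
    have h2 := min_one_div_two_le (a := m) (b := |X|) (by linarith)
    have h3 := min_one_div_two_le (a := p) (b := |Y|) (by linarith)
    have := mul_le_mul h2 h3 (by positivity) (by linarith)
    linarith

end Trigonometry

/-! ### A direction seeing all three vectors -/

section Directions

open scoped RealInnerProductSpace

/-- Give `a` the sign of `⟪u, v⟫`, so that the two contributions do not cancel. -/
lemma exists_perturb_le_abs_inner {E : Type*} [NormedAddCommGroup E] [InnerProductSpace ℝ E]
    (u v : E) {ε : ℝ} (hε : 0 ≤ ε) :
    ∃ a : ℝ, ‖a • v‖ ≤ ε ∧ ε * ‖v‖ ≤ |⟪u + a • v, v⟫| := by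
  by_cases hv : v = 0
  · exact ⟨0, by simpa using hε, by simp [hv]⟩
  have hv0 : 0 < ‖v‖ := norm_pos_iff.2 hv
  have hn : ‖(ε / ‖v‖) • v‖ = ε := by
    rw [norm_smul, Real.norm_of_nonneg (by positivity), div_mul_cancel₀ _ hv0.ne']
  have hi : ε / ‖v‖ * (‖v‖ * ‖v‖) = ε * ‖v‖ := by field_simp
  rcases le_total 0 ⟪u, v⟫ with h | h
  · refine ⟨ε / ‖v‖, hn.le, ?_⟩
    rw [inner_add_left, real_inner_smul_left, real_inner_self_eq_norm_mul_norm, hi]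
    exact le_trans (by linarith) (le_abs_self _)
  · refine ⟨-(ε / ‖v‖), by rw [neg_smul, norm_neg, hn], ?_⟩
    rw [inner_add_left, real_inner_smul_left, real_inner_self_eq_norm_mul_norm, neg_mul, hi]
    exact le_trans (by linarith) (neg_le_abs _)

/-- Three vectors have a common direction in their span along which none of them is short. -/
lemma exists_mem_span_le_abs_inner {E : Type*} [NormedAddCommGroup E] [InnerProductSpace ℝ E]
    (v₁ v₂ v₃ : E) :
    ∃ u ∈ Submodule.span ℝ {v₁, v₂, v₃}, ‖u‖ ≤ 2 ∧
      ‖v₁‖ / 16 ≤ |⟪u, v₁⟫| ∧ ‖v₂‖ / 16 ≤ |⟪u, v₂⟫| ∧ ‖v₃‖ / 16 ≤ |⟪u, v₃⟫| := by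
  -- Sizes `1`, `1/4`, `1/16` decay fast enough that later perturbations leave at least `1/16` of
  -- each earlier gain.
  obtain ⟨a₁, hn₁, h₁⟩ := exists_perturb_le_abs_inner 0 v₁ (zero_le_one' ℝ)
  obtain ⟨a₂, hn₂, h₂⟩ := exists_perturb_le_abs_inner (0 + a₁ • v₁) v₂
    (by norm_num : (0 : ℝ) ≤ 1 / 4)
  obtain ⟨a₃, hn₃, h₃⟩ := exists_perturb_le_abs_inner (0 + a₁ • v₁ + a₂ • v₂) v₃
    (by norm_num : (0 : ℝ) ≤ 1 / 16)
  have hpert (x y v : E) {ε : ℝ} (hy : ‖y‖ ≤ ε) : |⟪x, v⟫| - ε * ‖v‖ ≤ |⟪x + y, v⟫| := by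
    have h1 : |⟪y, v⟫| ≤ ε * ‖v‖ := (abs_real_inner_le_norm y v).trans (by gcongr)
    have h2 := abs_sub_abs_le_abs_add ⟪x, v⟫ ⟪y, v⟫
    rw [inner_add_left]
    linarith
  refine ⟨0 + a₁ • v₁ + a₂ • v₂ + a₃ • v₃, ?_, ?_, ?_, ?_, ?_⟩
  · have hmem {v : E} (hv : v ∈ ({v₁, v₂, v₃} : Set E)) (a : ℝ) :
        a • v ∈ Submodule.span ℝ {v₁, v₂, v₃} :=
      Submodule.smul_mem _ _ (Submodule.subset_span hv)
    exact add_mem (add_mem (add_mem (zero_mem _) (hmem (by simp) _)) (hmem (by simp) _))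
      (hmem (by simp) _)
  · have := norm_add₃_le (a := a₁ • v₁) (b := a₂ • v₂) (c := a₃ • v₃)
    rw [zero_add]
    linarith
  · have e1 := hpert (0 + a₁ • v₁) (a₂ • v₂) v₁ hn₂
    have e2 := hpert (0 + a₁ • v₁ + a₂ • v₂) (a₃ • v₃) v₁ hn₃
    linarith [norm_nonneg v₁]
  · have e2 := hpert (0 + a₁ • v₁ + a₂ • v₂) (a₃ • v₃) v₂ hn₃
    linarith [norm_nonneg v₂]
  · linarith

end Directions

/-! ### The quadratic form on `U` -/

section LambdaMax

variable {d : ℕ} {S : Matrix (Fin d) (Fin d) ℝ} {U : Submodule ℝ (EuclideanSpace ℝ (Fin d))}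

lemma lambdaMax_pos (hS : S.PosDef) (hU : U ≠ ⊥) : 0 < lambdaMax S U := by
  obtain ⟨⟨u, hu, -, h⟩, -⟩ := isGreatest_lambdaMax S U hU
  have hu0 : u.ofLp ≠ 0 := by
    intro h0
    have : u = 0 := by ext i; simp [h0]
    simp [this] at hu
  rw [h]
  simpa using hS.dotProduct_mulVec_pos hu0

lemma dotProduct_mulVec_le_lambdaMax {u : EuclideanSpace ℝ (Fin d)} (hu : u ∈ U) :
    u.ofLp ⬝ᵥ (S *ᵥ u.ofLp) ≤ lambdaMax S U * ‖u‖ ^ 2 := by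
  by_cases h0 : u = 0
  · simp [h0]
  have hn : 0 < ‖u‖ := norm_pos_iff.2 h0
  have hU : U ≠ ⊥ := fun h => h0 (by simpa [h] using hu)
  have h := (isGreatest_lambdaMax S U hU).2
    ⟨‖u‖⁻¹ • u, by simp [norm_smul, hn.ne'], U.smul_mem _ hu, rfl⟩
  simp only [WithLp.ofLp_smul, Matrix.mulVec_smul, dotProduct_smul, smul_dotProduct,
    smul_eq_mul] at h
  calc u.ofLp ⬝ᵥ (S *ᵥ u.ofLp)
      = ‖u‖⁻¹ * (‖u‖⁻¹ * (u.ofLp ⬝ᵥ (S *ᵥ u.ofLp))) * ‖u‖ ^ 2 := by field_simp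
    _ ≤ _ := by gcongr

end LambdaMax

/-! ### The two lower bounds -/

section LowerBound

open scoped RealInnerProductSpace

variable {d : ℕ} {S : Matrix (Fin d) (Fin d) ℝ} {U : Submodule ℝ (EuclideanSpace ℝ (Fin d))}

lemma exp_mul_trig_prod_le_tvDist (hS : S.PosDef) (hlam : 0 < lambdaMax S U)
    (μ₀ μ₁ μ₀' μ₁' : EuclideanSpace ℝ (Fin d)) {u : EuclideanSpace ℝ (Fin d)} (hu : u ∈ U)
    (hn : ‖u‖ ≤ 2) {X Y B t : ℝ} (ht0 : 0 ≤ t) (ht1 : t ≤ 1)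
    (hX : ⟪u, (μ₁ - μ₀) - (μ₁' - μ₀')⟫ = 4 * √(lambdaMax S U) * X)
    (hY : ⟪u, (μ₁ - μ₀) + (μ₁' - μ₀')⟫ = 4 * √(lambdaMax S U) * Y)
    (hB : ⟪u, (μ₀' + μ₁') - (μ₀ + μ₁)⟫ = 4 * √(lambdaMax S U) * B) :
    Real.exp (-2) * max |Real.sin (t * X) * Real.sin (t * Y) * Real.cos (t * B)|
        |Real.cos (t * X) * Real.cos (t * Y) * Real.sin (t * B)| ≤
      tvDist (gaussianMixture μ₀ μ₁ S) (gaussianMixture μ₀' μ₁' S) := by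
  have hs : 0 < √(lambdaMax S U) := Real.sqrt_pos.2 hlam
  have hmem : (t / √(lambdaMax S U)) • u ∈ U := U.smul_mem _ hu
  have hq := dotProduct_mulVec_le_lambdaMax (S := S) hmem
  have hq4 : lambdaMax S U * ‖(t / √(lambdaMax S U)) • u‖ ^ 2 ≤ 4 := by
    rw [norm_smul, Real.norm_of_nonneg (by positivity), mul_pow, div_pow, Real.sq_sqrt hlam.le,
      ← mul_assoc, mul_div_cancel₀ _ hlam.ne', ← mul_pow]
    have : t * ‖u‖ ≤ 2 := by nlinarith [norm_nonneg u]
    nlinarith [mul_nonneg ht0 (norm_nonneg u)]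
  refine le_trans ?_ (trig_prod_le_tvDist_gaussianMixture hS.posSemidef μ₀ μ₁ μ₀' μ₁'
    ((t / √(lambdaMax S U)) • u) (X := t * X) (Y := t * Y) (B := t * B) ?_ ?_ ?_)
  · gcongr
    linarith
  all_goals
    rw [real_inner_smul_left]
    first | rw [hX] | rw [hY] | rw [hB]
    field_simp

lemma min_mul_min_le_tvDist (hS : S.PosDef) (hlam : 0 < lambdaMax S U)
    {μ₀ μ₁ μ₀' μ₁' v₁ v₂ v₃ : EuclideanSpace ℝ (Fin d)}
    (h₁ : v₁ ∈ ({μ₁ - μ₀, μ₁' - μ₀'} : Set _)) (h₂ : v₂ ∈ ({μ₀' - μ₀, μ₁' - μ₁} : Set _))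
    (h₃ : v₃ ∈ ({μ₀' - μ₁, μ₁' - μ₀} : Set _)) (hU : U = Submodule.span ℝ {v₁, v₂, v₃}) :
    Real.exp (-2) / 2 ^ 18 * (min 1 (min ‖v₂‖ ‖v₃‖ / √(lambdaMax S U)) *
        min 1 (‖v₁‖ / √(lambdaMax S U))) ≤
      tvDist (gaussianMixture μ₀ μ₁ S) (gaussianMixture μ₀' μ₁' S) := by
  obtain ⟨u, hu, hn, hu₁, hu₂, hu₃⟩ := exists_mem_span_le_abs_inner v₁ v₂ v₃
  rw [← hU] at hu
  have hs : 0 < √(lambdaMax S U) := Real.sqrt_pos.2 hlam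
  have hq := fun X Y B t => exp_mul_trig_prod_le_tvDist (X := X) (Y := Y) (B := B) (t := t) hS hlam
    μ₀ μ₁ μ₀' μ₁' hu hn
  set s := √(lambdaMax S U) with hs_def
  have hdiv (r : ℝ) : r = 4 * s * (r / (4 * s)) := by field_simp
  -- Here `1/32 = 2 * (1/16) / 4`; with `256` from the trigonometric lemma, `2 ^ 18 = 256 * 32 ^ 2`.
  have hsplit {x y v : EuclideanSpace ℝ (Fin d)} (h : (2 : ℝ) • v = x + y)
      (hv : ‖v‖ / 16 ≤ |⟪u, v⟫|) : ‖v‖ / s / 32 ≤ |⟪u, x⟫ / (4 * s)| + |⟪u, y⟫ / (4 * s)| := by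
    have e : 2 * ⟪u, v⟫ = ⟪u, x⟫ + ⟪u, y⟫ := by
      rw [← real_inner_smul_right, h, inner_add_right]
    have h2 : 2 * |⟪u, v⟫| ≤ |⟪u, x⟫| + |⟪u, y⟫| := by
      rw [← abs_two (α := ℝ), ← abs_mul, e]
      exact abs_add_le _ _
    rw [abs_div, abs_div, ← add_div, abs_of_pos (by positivity : 0 < 4 * s), div_div,
      div_le_div_iff₀ (by positivity) (by positivity)]
    nlinarith
  have hneg (y : EuclideanSpace ℝ (Fin d)) : |⟪u, -y⟫ / (4 * s)| = |⟪u, y⟫ / (4 * s)| := by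
    rw [inner_neg_right, neg_div, abs_neg]
  obtain ⟨x, hx⟩ : ∃ x, x = (μ₁ - μ₀) - (μ₁' - μ₀') := ⟨_, rfl⟩
  obtain ⟨y, hy⟩ : ∃ y, y = (μ₁ - μ₀) + (μ₁' - μ₀') := ⟨_, rfl⟩
  obtain ⟨b, hb⟩ : ∃ b, b = (μ₀' + μ₁') - (μ₀ + μ₁) := ⟨_, rfl⟩
  rw [← hx, ← hy, ← hb] at hq
  have k₁ : ‖v₁‖ / s / 32 ≤ |⟪u, x⟫ / (4 * s)| + |⟪u, y⟫ / (4 * s)| := by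
    rcases h₁ with rfl | h₁
    · exact hsplit (by rw [hx, hy]; module) hu₁
    · rw [Set.mem_singleton_iff] at h₁
      have := hsplit (x := -x) (y := y) (v := v₁) (by rw [hx, hy, h₁]; module) hu₁
      rwa [hneg] at this
  have k₂ : ‖v₂‖ / s / 32 ≤ |⟪u, b⟫ / (4 * s)| + |⟪u, x⟫ / (4 * s)| := by
    rcases h₂ with rfl | h₂
    · exact hsplit (by rw [hx, hb]; module) hu₂
    · rw [Set.mem_singleton_iff] at h₂
      have := hsplit (x := b) (y := -x) (v := v₂) (by rw [hx, hb, h₂]; module) hu₂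
      rwa [hneg] at this
  have k₃ : ‖v₃‖ / s / 32 ≤ |⟪u, b⟫ / (4 * s)| + |⟪u, y⟫ / (4 * s)| := by
    rcases h₃ with rfl | h₃
    · have := hsplit (x := b) (y := -y) (by rw [hy, hb]; module) hu₃
      rwa [hneg] at this
    · rw [Set.mem_singleton_iff] at h₃
      exact hsplit (by rw [hy, hb, h₃]; module) hu₃
  obtain ⟨t, ht0, ht1, ht⟩ := exists_le_max_trig_prod (p := ‖v₁‖ / s / 32)
    (m := min ‖v₂‖ ‖v₃‖ / s / 32) (by positivity) (by positivity) k₁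
    (le_trans (by gcongr; exact min_le_left _ _) k₂)
    (le_trans (by gcongr; exact min_le_right _ _) k₃)
  refine le_trans ?_ (hq _ _ _ t ht0 ht1 (hdiv _) (hdiv _) (hdiv _))
  rw [div_mul_eq_mul_div, mul_div_assoc]
  gcongr
  refine le_trans ?_ ht
  have hmin {r : ℝ} (hr : 0 ≤ r) : min 1 r / 32 ≤ min 1 (r / 32) :=
    le_min (by linarith [min_le_left 1 r]) (by linarith [min_le_right 1 r])
  have := mul_le_mul (hmin (r := min ‖v₂‖ ‖v₃‖ / s) (by positivity))
    (hmin (r := ‖v₁‖ / s) (by positivity)) (by positivity) (by positivity)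
  linarith

/-- If the two centers of a mixture are close compared to the distance between the mixtures, then
the means of the mixtures are far apart, and separate the mixtures. -/
lemma min_div_sqrt_le_tvDist (hS : S.PosDef) (hlam : 0 < lambdaMax S U)
    {μ₀ μ₁ μ₀' μ₁' v : EuclideanSpace ℝ (Fin d)} (hv : v ∈ ({μ₀' - μ₀, μ₁' - μ₁} : Set _))
    (hvU : v ∈ U) (h₁ : ‖μ₁ - μ₀‖ ≤ ‖v‖ / 2) (h₁' : ‖μ₁' - μ₀'‖ ≤ ‖v‖ / 2) :
    Real.exp (-2) / 64 * min 1 (‖v‖ / √(lambdaMax S U)) ≤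
      tvDist (gaussianMixture μ₀ μ₁ S) (gaussianMixture μ₀' μ₁' S) := by
  rcases eq_or_ne v 0 with rfl | hv0
  · simpa using tvDist_nonneg
  have hvn : 0 < ‖v‖ := norm_pos_iff.2 hv0
  have hun : ‖‖v‖⁻¹ • v‖ = 1 := by simp [norm_smul, hvn.ne']
  have hs : 0 < √(lambdaMax S U) := Real.sqrt_pos.2 hlam
  have hq := fun X Y B t => exp_mul_trig_prod_le_tvDist (X := X) (Y := Y) (B := B) (t := t) hS hlam
    μ₀ μ₁ μ₀' μ₁' (U.smul_mem ‖v‖⁻¹ hvU) (by rw [hun]; norm_num)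
  set s := √(lambdaMax S U) with hs_def
  obtain ⟨u, hu⟩ : ∃ u, u = ‖v‖⁻¹ • v := ⟨_, rfl⟩
  rw [← hu] at hq hun
  have huv : ⟪u, v⟫ = ‖v‖ := by
    rw [hu, real_inner_smul_left, real_inner_self_eq_norm_mul_norm]
    field_simp
  have hdiv (r : ℝ) : r = 4 * s * (r / (4 * s)) := by field_simp
  obtain ⟨x, hx⟩ : ∃ x, x = (μ₁ - μ₀) - (μ₁' - μ₀') := ⟨_, rfl⟩
  obtain ⟨b, hb⟩ : ∃ b, b = (μ₀' + μ₁') - (μ₀ + μ₁) := ⟨_, rfl⟩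
  rw [← hx, ← hb] at hq
  have hxn : |⟪u, x⟫| ≤ ‖v‖ := by
    refine (abs_real_inner_le_norm u x).trans ?_
    rw [hun, one_mul, hx]
    exact (norm_sub_le _ _).trans (by linarith)
  -- Since `b = 2v ± x`, the `x` part can cancel at most half of `⟪u, 2v⟫ = 2‖v‖`.
  have hbn : ‖v‖ ≤ |⟪u, b⟫| := by
    refine le_trans ?_ (le_abs_self _)
    rw [abs_le] at hxn
    rcases hv with h | h
    · have e : b = (2 : ℝ) • v - x := by rw [hx, hb, h]; module
      rw [e, inner_sub_right, real_inner_smul_right, huv]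
      linarith
    · rw [Set.mem_singleton_iff] at h
      have e : b = (2 : ℝ) • v + x := by rw [hx, hb, h]; module
      rw [e, inner_add_right, real_inner_smul_right, huv]
      linarith
  have hXB : |⟪u, x⟫ / (4 * s)| ≤ |⟪u, b⟫ / (4 * s)| := by
    rw [abs_div, abs_div]
    exact div_le_div_of_nonneg_right (hxn.trans hbn) (abs_nonneg _)
  obtain ⟨t, ht0, ht1, ht⟩ := exists_min_le_abs_cos_cos_sin
    (⟪u, (μ₁ - μ₀) + (μ₁' - μ₀')⟫ / (4 * s)) hXB
  refine le_trans ?_ (hq _ _ _ t ht0 ht1 (hdiv _) (hdiv _) (hdiv _))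
  rw [div_mul_eq_mul_div, mul_div_assoc]
  gcongr
  refine le_trans ?_ (le_max_of_le_right ht)
  have hB : ‖v‖ / s / 4 ≤ |⟪u, b⟫ / (4 * s)| := by
    rw [abs_div, abs_of_pos (by positivity : 0 < 4 * s), div_div, mul_comm s]
    gcongr
  have : min 1 (‖v‖ / s) / 4 ≤ min 1 |⟪u, b⟫ / (4 * s)| :=
    le_min (by linarith [min_le_left 1 (‖v‖ / s)]) (by linarith [min_le_right 1 (‖v‖ / s)])
  linarith

end LowerBound

/-! ### Combining the regimes -/

/-- For `N ≤ 1`, `K * P ≤ 1` makes `min 1 P` at least a multiple of `P`; for `N ≥ 1`, `P ≥ 1/2`. The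
constant is below both `K` and `1/2`. -/
lemma min_one_mul_le_min_one_mul_min_one {K P N : ℝ} (hK : 0 < K) (hP : 0 ≤ P) (hN : 0 ≤ N)
    (hNP : N / 2 ≤ P) (hKP : K * P ≤ 1) :
    K / (2 * (1 + K) ^ 2) * min 1 (P * N) ≤ min 1 N * min 1 P := by
  have hκ0 : 0 < K / (2 * (1 + K) ^ 2) := by positivity
  have hκK : K / (2 * (1 + K) ^ 2) ≤ K := div_le_self hK.le (by nlinarith)
  have hκ : K / (2 * (1 + K) ^ 2) ≤ 1 / 2 := by
    rw [div_le_div_iff₀ (by positivity) two_pos]; nlinarith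
  set κ := K / (2 * (1 + K) ^ 2)
  rcases le_total N 1 with h | h
  · rw [min_eq_right h]
    calc κ * min 1 (P * N) ≤ κ * (P * N) := by gcongr; exact min_le_right _ _
      _ = N * (κ * P) := by ring
      _ ≤ N * min 1 P := by
        gcongr
        exact le_min (by nlinarith) (by nlinarith)
  · rw [min_eq_left h, one_mul]
    exact le_trans (by nlinarith [min_le_left 1 (P * N)])
      (le_min (by norm_num) (by linarith) : 1 / 2 ≤ min 1 P)

theorem theorem1 :
    ∀ K : ℝ, 0 < K → ∃ c : ℝ, 0 < c ∧
      ∀ (d : ℕ) (S : Matrix (Fin d) (Fin d) ℝ), S.PosDef →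
      ∀ μ₀ μ₁ μ₀' μ₁' v₁ v₂ v₃ : EuclideanSpace ℝ (Fin d),
        IsLongestIn {μ₁ - μ₀, μ₁' - μ₀'} v₁ →
        IsLongestIn {μ₀' - μ₀, μ₁' - μ₁} v₂ →
        IsLongestIn {μ₀' - μ₁, μ₁' - μ₀} v₃ →
        ∀ lam : ℝ, lam = lambdaMax S (Submodule.span ℝ {v₁, v₂, v₃}) →
          ((min ‖v₂‖ ‖v₃‖ / 2 ≤ ‖v₁‖ ∧ K * ‖v₁‖ ≤ √lam) →
            c * min 1 (‖v₁‖ * min ‖v₂‖ ‖v₃‖ / lam) ≤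
              tvDist (gaussianMixture μ₀ μ₁ S) (gaussianMixture μ₀' μ₁' S)) ∧
          (¬ (min ‖v₂‖ ‖v₃‖ / 2 ≤ ‖v₁‖ ∧ K * ‖v₁‖ ≤ √lam) →
            c * min 1 (min ‖v₂‖ ‖v₃‖ / √lam) ≤
              tvDist (gaussianMixture μ₀ μ₁ S) (gaussianMixture μ₀' μ₁' S)) := by
  intro K hK
  have hκ0 : 0 < K / (2 * (1 + K) ^ 2) := by positivity
  have hκK : K / (2 * (1 + K) ^ 2) * K ≤ 1 := by
    rw [div_mul_eq_mul_div, div_le_one (by positivity)]; nlinarith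
  have hκ1 : K / (2 * (1 + K) ^ 2) ≤ 1 := by rw [div_le_one (by positivity)]; nlinarith
  refine ⟨Real.exp (-2) / 2 ^ 18 * (K / (2 * (1 + K) ^ 2)), by positivity, ?_⟩
  intro d S hS μ₀ μ₁ μ₀' μ₁' v₁ v₂ v₃ h₁ h₂ h₃ lam hlam
  by_cases hU : Submodule.span ℝ {v₁, v₂, v₃} = ⊥
  · have hv₂ : v₂ = 0 := by
      have : v₂ ∈ Submodule.span ℝ {v₁, v₂, v₃} := Submodule.subset_span (by simp)
      simpa [hU] using this
    simp [hv₂, tvDist_nonneg]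
  have hpos := lambdaMax_pos hS hU
  have hmain := min_mul_min_le_tvDist hS hpos h₁.1 h₂.1 h₃.1 rfl
  have hmean := min_div_sqrt_le_tvDist hS hpos h₂.1 (Submodule.subset_span (by simp))
  rw [← hlam] at hpos hmain hmean
  have hs : 0 < √lam := Real.sqrt_pos.2 hpos
  have hmin : 0 ≤ min ‖v₂‖ ‖v₃‖ := by positivity
  have hexp : 0 < Real.exp (-2) / 2 ^ 18 := by positivity
  refine ⟨fun h => le_trans ?_ hmain, fun h => ?_⟩
  · rw [mul_assoc]
    refine mul_le_mul_of_nonneg_left ?_ hexp.le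
    have e : ‖v₁‖ * min ‖v₂‖ ‖v₃‖ / lam = ‖v₁‖ / √lam * (min ‖v₂‖ ‖v₃‖ / √lam) := by
      rw [div_mul_div_comm, Real.mul_self_sqrt hpos.le]
    rw [e]
    refine min_one_mul_le_min_one_mul_min_one hK (by positivity) (by positivity) ?_ ?_
    · rw [div_right_comm]
      gcongr
      exact h.1
    · rw [← mul_div_assoc, div_le_one hs]
      exact h.2
  · rcases le_or_gt (min ‖v₂‖ ‖v₃‖ / 2) ‖v₁‖ with hv | hv
    -- Now `‖v₁‖ / √lam > 1 / K`, so the `v₁` factor of `hmain` is bounded below.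
    · have hK1 : √lam < K * ‖v₁‖ := lt_of_not_ge fun h' => h ⟨hv, h'⟩
      refine le_trans ?_ hmain
      rw [mul_assoc, mul_comm (min 1 (min ‖v₂‖ ‖v₃‖ / √lam))]
      gcongr
      refine le_min hκ1 ?_
      rw [le_div_iff₀ hs]
      nlinarith [norm_nonneg v₁]
    · have hle := min_le_left ‖v₂‖ ‖v₃‖
      refine le_trans ?_ (hmean
        ((h₁.2 _ (by simp)).trans (by linarith)) ((h₁.2 _ (by simp)).trans (by linarith)))
      have hc : Real.exp (-2) / 2 ^ 18 * (K / (2 * (1 + K) ^ 2)) ≤ Real.exp (-2) / 64 :=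
        calc _ ≤ Real.exp (-2) / 2 ^ 18 * 1 := by gcongr
          _ ≤ _ := by rw [mul_one]; gcongr; norm_num
      gcongr
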